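/- Let $p_1(1),p_1(2),\dots$ be i.i.d. random variables with values in $(0,1)$, let $p_2(1),p_2(2),\dots$ be i.i.d. random variables with values in $(0,1)$ on the same probability space (the joint law of the two sequences is arbitrary), and put $p_1(0)=p_2(0)=1$. Assume that for $k=1,2$ $$\mu_k=E\left[\log\frac{1-p_k(1)}{p_k(1)}\right]>0,$$ where the expectation is assumed to be well defined and the value $+\infty$ is allowed. (For example, $p_k(1)$ may have the Beta distribution with parameters $(a_k,b_k)$, $0<a_k<b_k$: the expectation is then well defined and positive.) Let $(Z^r_t)_{t\ge 0}$ and $(Z^l_t)_{t\ge 0}$ be continuous-time processes on $\{0,1,2,\dots\}$ such that, conditionally on the environments $(p_1(i))_i$ and $(p_2(i))_i$, they are independent birth-and-death chains with arbitrary initial distributions, where $Z^r$ jumps from $i$ to $i+1$ at rate $p_1(i)$ and from $i$ to $i-1$ at rate $1-p_1(i)$, and $Z^l$ jumps from $i$ to $i+1$ at rate $p_2(i)$ and from $i$ to $i-1$ at rate $1-p_2(i)$. Then, almost surely, $(Z^l_t,Z^r_t)$ returns to $(0,0)$ infinitely often, that is, for every $T$ there are times $T<s<t$ with $(Z^l_s,Z^r_s)\ne(0,0)$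 and $(Z^l_t,Z^r_t)=(0,0)$. Equivalently, if $\widetilde Z^l_t=-Z^l_t$ denotes the mirrored chain on $\{0,-1,-2,\dots\}$, which jumps from $-i$ to $-(i+1)$ at rate $p_2(i)$ and from $-i$ to $-(i-1)$ at rate $1-p_2(i)$, then almost surely $Z^r_t-\widetilde Z^l_t$ returns to $0$ infinitely often, so $Z^r-\widetilde Z^l$ is recurrent. -/

import Mathlib

open MeasureTheory ProbabilityTheory Filter Topology
open scoped NNReal ENNReal

/-- The expectation of `X` is well defined and strictly positive, the value `+∞` being allowed:
`E[X⁻] < E[X⁺]` (so that `E[X⁻]` is finite). -/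
def HasPositiveMean {Ω : Type*} [MeasurableSpace Ω] (P : Measure Ω) (X : Ω → ℝ) : Prop :=
  ∫⁻ ω, ENNReal.ofReal (-X ω) ∂P < ∫⁻ ω, ENNReal.ofReal (X ω) ∂P

/-- A random environment on the half-line: `p 0 = 1`, and `p 1, p 2, …` are i.i.d. random
variables with values in `(0, 1)` such that `E[log ((1 - p i) / p i)] > 0`. -/
structure IsEnvironment {Ω : Type*} [MeasurableSpace Ω] (P : Measure Ω) (p : ℕ → Ω → ℝ) :
    Prop where
  measurable : ∀ i, Measurable (p i)
  zero : ∀ ω, p 0 ω = 1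
  mem_Ioo : ∀ i ω, p (i + 1) ω ∈ Set.Ioo (0 : ℝ) 1
  indep : iIndepFun (fun i => p (i + 1)) P
  identDistrib : ∀ i, IdentDistrib (p (i + 1)) (p 1) P P
  drift : HasPositiveMean P (fun ω => Real.log ((1 - p 1 ω) / p 1 ω))

/-- The transition probabilities of the birth-and-death jump chain on `ℕ` with forward
probabilities `p`: from `i` to `i + 1` with probability `p i`, from `i` to `i - 1` with
probability `1 - p i`. -/
noncomputable def birthDeathMatrix (p : ℕ → ℝ) (i j : ℕ) : ℝ :=
  if j = i + 1 then p i else if i = j + 1 then 1 - p i else 0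

/-- `Y` is a discrete-time Markov chain on `ℕ` with transition probabilities `K`
(and an arbitrary initial distribution). -/
structure IsMarkovChain {Ω : Type*} [MeasurableSpace Ω] (μ : Measure Ω) (K : ℕ → ℕ → ℝ)
    (Y : ℕ → Ω → ℕ) : Prop where
  measurable : ∀ n, Measurable (Y n)
  markov : ∀ (n : ℕ) (i : ℕ → ℕ),
    μ {ω | ∀ k ≤ n + 1, Y k ω = i k} =
      μ {ω | ∀ k ≤ n, Y k ω = i k} * ENNReal.ofReal (K (i n) (i (n + 1)))

/-- `N` is a Poisson process of rate one: the number of rings, up to each time, of a clock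
with independent exponential waiting times of rate one. -/
structure IsPoissonClock {Ω : Type*} [MeasurableSpace Ω] (μ : Measure Ω)
    (N : ℝ≥0 → Ω → ℕ) : Prop where
  measurable : ∀ t, Measurable (N t)
  zero : ∀ᵐ ω ∂μ, N 0 ω = 0
  mono : ∀ᵐ ω ∂μ, Monotone (fun t => N t ω)
  rightCont : ∀ᵐ ω ∂μ, ∀ t, ∀ᶠ s in 𝓝[>] t, N s ω = N t ω
  indepIncrements : HasIndepIncrements N μ
  increments : ∀ s t, s ≤ t → μ.map (fun ω => N t ω - N s ω) = poissonMeasure (t - s)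

/-- `Z` is the (continuous-time) birth-and-death chain on `ℕ` with forward rates `p` and
backward rates `1 - p`: at the rings of a rate-one Poisson clock it makes the steps of a
discrete birth-and-death chain that is independent of the clock. -/
structure IsBirthDeathChain {Ω : Type*} [MeasurableSpace Ω] (μ : Measure Ω) (p : ℕ → ℝ)
    (Z : ℝ≥0 → Ω → ℕ) : Prop where
  measurable : ∀ t, Measurable (Z t)
  exists_jumpChain : ∃ (N : ℝ≥0 → Ω → ℕ) (Y : ℕ → Ω → ℕ),
    IsPoissonClock μ N ∧ IsMarkovChain μ (birthDeathMatrix p) Y ∧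
      IndepFun (fun ω t => N t ω) (fun ω n => Y n ω) μ ∧
      ∀ᵐ ω ∂μ, ∀ t, Z t ω = Y (N t ω) ω

/-- The path `x` returns to the state `a` infinitely often: after every time `T` there are a
time at which it is away from `a` and a later time at which it is at `a`. -/
def ReturnsInfinitelyOften {S : Type*} (x : ℝ≥0 → S) (a : S) : Prop :=
  ∀ T : ℝ≥0, ∃ s t : ℝ≥0, T < s ∧ s < t ∧ x s ≠ a ∧ x t = a

/-! Given its environment, each walk is reversible with respect to the weights $w_0=1$,
$w_{n+1}=e^{-V_n}+e^{-V_{n+1}}$, where $V_n=\sum_{i=1}^n\log\frac{1-p(i)}{p(i)}$. The law of large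
numbers makes $V$ grow at least linearly, so $w$ has finite total mass for almost every environment
(`IsEnvironment.ae_tsum_birthDeathWeight_ne_top`). Only almost sure statements about each
environment separately are used, which is why their joint law is irrelevant.

The two walks are conditionally independent, so the product of the two weights is a finite invariant
measure for the pair, which is therefore positive recurrent. Continuous time is avoided by looking
at integer times only: there each walk makes independent Poisson(1) numbers of jump-chain steps and
is a Markov chain (`HasTransitions.subordinate`), and so is the pair (`HasTransitions.prodMk`).
Poisson(1) charges every number of steps, so all transition probabilities are positive and the
period two of the jump chains is no obstruction. Such a chain with a finite invariant measure hits
each charged state infinitely often (`HasTransitions.ae_frequently_eq`). Infinitely many visits to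
both $(0,0)$ and $(1,0)$ give the returns. -/

/-- A set is decomposed along the fibres of a map with countable range. -/
theorem measure_eq_tsum_inter_fiber {Ω ι : Type*} [MeasurableSpace Ω] [MeasurableSpace ι]
    [Countable ι] [MeasurableSingletonClass ι] (μ : Measure Ω) {H : Ω → ι} (hH : Measurable H)
    (E : Set Ω) : μ E = ∑' h, μ (E ∩ H ⁻¹' {h}) := by
  have h1 := tsum_measure_preimage_singleton (μ := μ.restrict E) (s := (Set.univ : Set ι))
    (Set.to_countable _) (f := H) (fun y _ => hH (measurableSet_singleton y))
  rw [Set.preimage_univ, Measure.restrict_apply_univ,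
    tsum_univ (fun b => μ.restrict E (H ⁻¹' {b}))] at h1
  rw [← h1]
  refine tsum_congr fun h => ?_
  rw [Measure.restrict_apply (hH (measurableSet_singleton h)), Set.inter_comm]

/-! ### Markov chains on a countable state space and events of their past -/

/-- `X` is a Markov chain on `S` with the `ℝ≥0∞`-valued transition matrix `Q`. -/
structure HasTransitions {Ω S : Type*} [MeasurableSpace Ω] [MeasurableSpace S] (μ : Measure Ω)
    (Q : S → S → ℝ≥0∞) (X : ℕ → Ω → S) : Prop where
  measurable : ∀ n, Measurable (X n)
  markov : ∀ (n : ℕ) (i : ℕ → S),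
    μ {ω | ∀ k ≤ n + 1, X k ω = i k} = μ {ω | ∀ k ≤ n, X k ω = i k} * Q (i n) (i (n + 1))

/-- `E` is an event of the past of `X` up to time `m`. -/
def IsPastEvent {Ω S : Type*} (X : ℕ → Ω → S) (m : ℕ) (E : Set Ω) : Prop :=
  ∀ ω ω', (∀ k ≤ m, X k ω = X k ω') → ω ∈ E → ω' ∈ E

namespace IsPastEvent

variable {Ω S : Type*} {X : ℕ → Ω → S} {m n : ℕ} {E F : Set Ω}

theorem mono (h : IsPastEvent X m E) (hmn : m ≤ n) : IsPastEvent X n E :=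
  fun ω ω' hk hω => h ω ω' (fun k hkm => hk k (hkm.trans hmn)) hω

theorem inter (hE : IsPastEvent X m E) (hF : IsPastEvent X m F) : IsPastEvent X m (E ∩ F) :=
  fun ω ω' hk hω => ⟨hE ω ω' hk hω.1, hF ω ω' hk hω.2⟩

theorem fiber (X : ℕ → Ω → S) (m : ℕ) (x : S) : IsPastEvent X m (X m ⁻¹' {x}) := by
  intro ω ω' hk hω
  simp only [Set.mem_preimage, Set.mem_singleton_iff] at hω ⊢
  rw [← hk m le_rfl, hω]

end IsPastEvent

/-- Powers of an `ℝ≥0∞`-valued matrix. -/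
noncomputable def stepPow {S : Type*} (K : S → S → ℝ≥0∞) : ℕ → S → S → ℝ≥0∞
  | 0 => fun x y => by classical exact if x = y then 1 else 0
  | d + 1 => fun x y => ∑' l, stepPow K d x l * K l y

/-- The probability that the chain started at `x` is away from `o` at the times `1, …, n`. -/
noncomputable def avoidProb {S : Type*} (Q : S → S → ℝ≥0∞) (o : S) : ℕ → S → ℝ≥0∞
  | 0 => fun _ => 1
  | n + 1 => fun x => ∑' y, by classical exact if y = o then 0 else Q x y * avoidProb Q o n y

namespace HasTransitions

variable {Ω S : Type*} [MeasurableSpace Ω] [MeasurableSpace S] [Countable S]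
  [MeasurableSingletonClass S] {μ : Measure Ω} {Q : S → S → ℝ≥0∞} {X : ℕ → Ω → S}

/-- A past event is a countable disjoint union of cylinders fixing the whole history up to time `m`,
and on each cylinder the identity is the defining Markov property. -/
theorem measure_inter_step (hX : HasTransitions μ Q X) {m : ℕ} {E : Set Ω}
    (hE : IsPastEvent X m E) (x y : S) :
    μ (E ∩ X m ⁻¹' {x} ∩ X (m + 1) ⁻¹' {y}) = μ (E ∩ X m ⁻¹' {x}) * Q x y := by
  have hH : Measurable (fun ω (k : Fin (m + 1)) => X k ω) :=
    measurable_pi_lambda _ fun k => hX.measurable k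
  rw [measure_eq_tsum_inter_fiber μ hH, measure_eq_tsum_inter_fiber μ hH (E ∩ X m ⁻¹' {x}),
    ← ENNReal.tsum_mul_right]
  refine tsum_congr fun h => ?_
  by_cases hne : ∃ ω₀, ω₀ ∈ E ∩ X m ⁻¹' {x} ∧ (fun k : Fin (m + 1) => X k ω₀) = h
  · obtain ⟨ω₀, ⟨hω₀E, hω₀x⟩, rfl⟩ := hne
    have hpast : ∀ ω, (fun k : Fin (m + 1) => X k ω) = (fun k : Fin (m + 1) => X k ω₀) ↔
        ∀ k ≤ m, X k ω = X k ω₀ := by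
      intro ω
      constructor
      · intro h k hk
        exact congrFun h ⟨k, by omega⟩
      · intro h
        funext k
        exact h k (by omega)
    have hmem : ∀ ω, (∀ k ≤ m, X k ω = X k ω₀) → ω ∈ E ∧ X m ω = x := by
      intro ω h
      exact ⟨hE ω₀ ω (fun k hk => (h k hk).symm) hω₀E, by rw [h m le_rfl]; exact hω₀x⟩
    -- The trajectory follows the history of `ω₀` up to time `m` and then jumps to `y`.
    have hmk := hX.markov m (fun k => if k ≤ m then X k ω₀ else y)
    have h1 : {ω | ∀ k ≤ m + 1, X k ω = if k ≤ m then X k ω₀ else y} =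
        E ∩ X m ⁻¹' {x} ∩ X (m + 1) ⁻¹' {y} ∩
          (fun ω (k : Fin (m + 1)) => X k ω) ⁻¹' {fun k : Fin (m + 1) => X k ω₀} := by
      ext ω
      simp only [Set.mem_ofPred_eq, Set.mem_inter_iff, Set.mem_preimage, Set.mem_singleton_iff,
        hpast]
      constructor
      · intro h
        have h' : ∀ k ≤ m, X k ω = X k ω₀ := fun k hk => by
          simpa [hk] using h k (by omega)
        exact ⟨⟨hmem ω h', by simpa using h (m + 1) le_rfl⟩, h'⟩
      · rintro ⟨⟨-, hy⟩, h'⟩ k hk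
        by_cases hkm : k ≤ m
        · simpa [hkm] using h' k hkm
        · obtain rfl : k = m + 1 := by omega
          simpa using hy
    have h2 : {ω | ∀ k ≤ m, X k ω = if k ≤ m then X k ω₀ else y} =
        E ∩ X m ⁻¹' {x} ∩
          (fun ω (k : Fin (m + 1)) => X k ω) ⁻¹' {fun k : Fin (m + 1) => X k ω₀} := by
      ext ω
      simp only [Set.mem_ofPred_eq, Set.mem_inter_iff, Set.mem_preimage, Set.mem_singleton_iff,
        hpast]
      constructor
      · intro h
        have h' : ∀ k ≤ m, X k ω = X k ω₀ := fun k hk => by simpa [hk] using h k hk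
        exact ⟨hmem ω h', h'⟩
      · rintro ⟨-, h'⟩ k hk
        simpa [hk] using h' k hk
    rw [h1, h2] at hmk
    have hx : X m ω₀ = x := hω₀x
    simpa [hx] using hmk
  · have h0 : E ∩ X m ⁻¹' {x} ∩ (fun ω (k : Fin (m + 1)) => X k ω) ⁻¹' {h} = ∅ := by
      ext ω
      simp only [Set.mem_inter_iff, Set.mem_preimage, Set.mem_singleton_iff,
        Set.mem_empty_iff_false, iff_false]
      rintro ⟨h1, h2⟩
      exact hne ⟨ω, h1, h2⟩
    rw [h0, Set.inter_right_comm, h0]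
    simp

theorem measure_inter_steps (hX : HasTransitions μ Q X) {m : ℕ} {E : Set Ω}
    (hE : IsPastEvent X m E) (x : S) (d : ℕ) (y : S) :
    μ (E ∩ X m ⁻¹' {x} ∩ X (m + d) ⁻¹' {y}) = μ (E ∩ X m ⁻¹' {x}) * stepPow Q d x y := by
  induction d generalizing y with
  | zero =>
    simp only [stepPow, add_zero]
    split_ifs with h
    · subst h
      rw [Set.inter_assoc, Set.inter_self, mul_one]
    · rw [mul_zero]
      convert measure_empty (μ := μ)
      ext ω
      simp only [Set.mem_inter_iff, Set.mem_preimage, Set.mem_singleton_iff,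
        Set.mem_empty_iff_false, iff_false]
      rintro ⟨⟨-, h1⟩, h2⟩
      exact h (h1.symm.trans h2)
  | succ d ih =>
    rw [measure_eq_tsum_inter_fiber μ (hX.measurable (m + d))]
    simp only [stepPow]
    rw [← ENNReal.tsum_mul_left]
    refine tsum_congr fun l => ?_
    rw [Set.inter_right_comm, ← add_assoc, measure_inter_step hX (E := E ∩ X m ⁻¹' {x})
      ((hE.inter (IsPastEvent.fiber X m x)).mono (Nat.le_add_right m d)), ih, mul_assoc]

/-- First-step decomposition at time `m + 1`. The induction generalizes over `m` and `E` because
after one step the condition on `X m` is absorbed into the past event. -/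
theorem measure_inter_avoid (hX : HasTransitions μ Q X) (o : S) (n : ℕ) {m : ℕ} {E : Set Ω}
    (hE : IsPastEvent X m E) (x : S) :
    μ (E ∩ X m ⁻¹' {x} ∩ {ω | ∀ k < n, X (m + 1 + k) ω ≠ o}) =
      μ (E ∩ X m ⁻¹' {x}) * avoidProb Q o n x := by
  induction n generalizing m E x with
  | zero => simp [avoidProb]
  | succ n ih =>
    rw [measure_eq_tsum_inter_fiber μ (hX.measurable (m + 1))]
    simp only [avoidProb]
    rw [← ENNReal.tsum_mul_left]
    refine tsum_congr fun y => ?_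
    split_ifs with h
    · rw [mul_zero]
      convert measure_empty (μ := μ)
      ext ω
      simp only [Set.mem_inter_iff, Set.mem_preimage, Set.mem_singleton_iff,
        Set.mem_empty_iff_false, iff_false]
      rintro ⟨⟨-, h1⟩, h2⟩
      exact h1 0 (by omega) (h2.trans h)
    · rw [← mul_assoc, ← measure_inter_step hX hE,
        ← ih (E := E ∩ X m ⁻¹' {x})
          ((hE.inter (IsPastEvent.fiber X m x)).mono (Nat.le_add_right m 1))]
      congr 1
      ext ω
      simp only [Set.mem_inter_iff, Set.mem_preimage, Set.mem_singleton_iff, Set.mem_ofPred_eq]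
      constructor
      · rintro ⟨⟨h1, h2⟩, h3⟩
        refine ⟨⟨h1, h3⟩, fun k hk => ?_⟩
        have := h2 (k + 1) (by omega)
        rwa [← add_assoc, add_right_comm] at this
      · rintro ⟨⟨h1, h3⟩, h2⟩
        refine ⟨⟨h1, fun k hk => ?_⟩, h3⟩
        cases k with
        | zero => rw [add_zero, h3]; exact h
        | succ k =>
          have := h2 k (by omega)
          rwa [add_right_comm, add_assoc] at this

end HasTransitions

/-! ### Recurrence from a finite invariant measure -/

section Recurrence

variable {S : Type*} {Q : S → S → ℝ≥0∞} {o : S}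

theorem avoidProb_le_one (hQ : ∀ x, ∑' y, Q x y ≤ 1) (n : ℕ) (x : S) : avoidProb Q o n x ≤ 1 := by
  induction n generalizing x with
  | zero => simp [avoidProb]
  | succ n ih =>
    refine le_trans (ENNReal.tsum_le_tsum fun y => ?_) (hQ x)
    split_ifs
    · exact zero_le
    · exact mul_le_of_le_one_right' (ih y)

theorem avoidProb_antitone (hQ : ∀ x, ∑' y, Q x y ≤ 1) (x : S) :
    Antitone fun n => avoidProb Q o n x := by
  refine antitone_nat_of_succ_le fun n => ?_
  induction n generalizing x with
  | zero => exact avoidProb_le_one hQ 1 x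
  | succ n ih =>
    refine ENNReal.tsum_le_tsum fun y => ?_
    split_ifs
    · exact le_rfl
    · exact mul_le_mul_right (ih y) _

/-- Monotone convergence for decreasing sequences of sums. -/
theorem tsum_iInf_of_antitone {f : ℕ → S → ℝ≥0∞} (hf : ∀ x, Antitone fun n => f n x)
    (h0 : ∑' x, f 0 x ≠ ∞) : ∑' x, ⨅ n, f n x = ⨅ n, ∑' x, f n x := by
  let _ : MeasurableSpace S := ⊤
  have h := lintegral_iInf (μ := Measure.count) (f := f) (fun n => measurable_from_top)
    (fun m n hmn x => hf x hmn) (by rwa [lintegral_count])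
  simpa only [lintegral_count] using h

/-- A chain with positive transition matrix and a finite invariant measure visits every state. -/
theorem iInf_avoidProb_eq_zero (hQ : ∀ x, ∑' y, Q x y ≤ 1) (hpos : ∀ x y, Q x y ≠ 0)
    {π : S → ℝ≥0∞} (hπ : ∑' x, π x ≠ ∞) (hinv : ∀ y, ∑' x, π x * Q x y = π y) (ho : π o ≠ 0)
    (x : S) : ⨅ n, avoidProb Q o n x = 0 := by
  classical
  -- `q x` is the probability of never hitting `o` at a positive time; it solves the first-step
  -- equation `hstep`.
  set q : S → ℝ≥0∞ := fun x => ⨅ n, avoidProb Q o n x with hq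
  have hq1 : ∀ x, q x ≤ 1 := fun x => iInf_le_of_le 0 (avoidProb_le_one hQ 0 x)
  have hrow : ∀ x, ∑' y, Q x y ≠ ∞ := fun x => ((hQ x).trans_lt ENNReal.one_lt_top).ne
  have hQtop : ∀ x y, Q x y ≠ ∞ := fun x y =>
    ((ENNReal.le_tsum y).trans_lt (lt_top_iff_ne_top.2 (hrow x))).ne
  have hstep : ∀ x, q x = ∑' y, if y = o then 0 else Q x y * q y := by
    intro x
    have h1 : q x = ⨅ n, avoidProb Q o (n + 1) x :=
      ((avoidProb_antitone hQ x).iInf_nat_add 1).symm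
    rw [h1]
    simp only [avoidProb]
    rw [← tsum_iInf_of_antitone]
    · refine tsum_congr fun y => ?_
      split_ifs
      · simp
      · rw [hq, ENNReal.mul_iInf_of_ne (hpos x y) (hQtop x y)]
    · intro y m n hmn
      dsimp only
      split_ifs
      · exact le_rfl
      · exact mul_le_mul_right (avoidProb_antitone hQ y hmn) _
    · refine ne_top_of_le_ne_top (hrow x) (ENNReal.tsum_le_tsum fun y => ?_)
      split_ifs
      · exact zero_le
      · simp [avoidProb]
  have hsplit : ∀ x, q x + Q x o * q o = ∑' y, Q x y * q y := by
    intro x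
    rw [hstep x, ← tsum_ite_eq o (fun y => Q x y * q y), ← ENNReal.tsum_add]
    refine tsum_congr fun y => ?_
    split_ifs <;> simp
  -- Integrating `hsplit` against `π` and using invariance twice leaves an excess `π o * q o`, which
  -- must vanish because `∑ π q` is finite.
  have hint : ∑' x, π x * q x + π o * q o = ∑' x, π x * q x := by
    calc ∑' x, π x * q x + π o * q o
        = ∑' x, π x * (q x + Q x o * q o) := by
          simp_rw [mul_add, ← mul_assoc]
          rw [ENNReal.tsum_add, ENNReal.tsum_mul_right, hinv]
      _ = ∑' x, ∑' y, π x * Q x y * q y := by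
          simp_rw [hsplit, ← ENNReal.tsum_mul_left, mul_assoc]
      _ = ∑' y, π y * q y := by
          rw [ENNReal.tsum_comm]
          refine tsum_congr fun y => ?_
          rw [ENNReal.tsum_mul_right, hinv]
  have hfin : ∑' x, π x * q x ≠ ∞ :=
    ne_top_of_le_ne_top hπ (ENNReal.tsum_le_tsum fun x => mul_le_of_le_one_right' (hq1 x))
  have hqo : q o = 0 := by
    have h0 : π o * q o = 0 := by
      refine (ENNReal.add_right_inj hfin).1 ?_
      rw [hint, add_zero]
    exact (mul_eq_zero.1 h0).resolve_left ho
  -- With `q o = 0`, the equation at `o` reads `0 = ∑ Q o y * q y`, and positivity of the row forces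
  -- `q = 0` everywhere.
  have hall := hsplit o
  rw [hqo, mul_zero, add_zero, eq_comm, ENNReal.tsum_eq_zero] at hall
  exact (mul_eq_zero.1 (hall x)).resolve_left (hpos o x)

/-- A chain with positive transition matrix and a finite invariant measure visits a state of
positive mass infinitely often, whatever its initial distribution. -/
theorem HasTransitions.ae_frequently_eq {Ω : Type*} [MeasurableSpace Ω] [MeasurableSpace S]
    [Countable S] [MeasurableSingletonClass S] {μ : Measure Ω} [IsFiniteMeasure μ]
    {X : ℕ → Ω → S} (hX : HasTransitions μ Q X)
    (hQ : ∀ x, ∑' y, Q x y ≤ 1) (hpos : ∀ x y, Q x y ≠ 0)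
    {π : S → ℝ≥0∞} (hπ : ∑' x, π x ≠ ∞) (hinv : ∀ y, ∑' x, π x * Q x y = π y) (ho : π o ≠ 0) :
    ∀ᵐ ω ∂μ, ∀ m, ∃ n, m < n ∧ X n ω = o := by
  rw [ae_all_iff]
  intro m
  have hle : ∀ x, μ (X m ⁻¹' {x} ∩ {ω | ∀ k, X (m + 1 + k) ω ≠ o}) = 0 := by
    intro x
    have h1 : ∀ n, μ (X m ⁻¹' {x} ∩ {ω | ∀ k, X (m + 1 + k) ω ≠ o}) ≤
        μ (X m ⁻¹' {x}) * avoidProb Q o n x := by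
      intro n
      have h2 := hX.measure_inter_avoid o n (m := m) (E := Set.univ)
        (fun _ _ _ _ => Set.mem_univ _) x
      rw [Set.univ_inter] at h2
      rw [← h2]
      exact measure_mono (Set.inter_subset_inter_right _ fun ω h k _ => h k)
    refine le_antisymm ?_ zero_le
    calc _ ≤ ⨅ n, μ (X m ⁻¹' {x}) * avoidProb Q o n x := le_iInf h1
      _ = 0 := by
        rw [← ENNReal.mul_iInf fun h => absurd h (measure_ne_top μ _),
          iInf_avoidProb_eq_zero hQ hpos hπ hinv ho, mul_zero]
  rw [ae_iff, measure_eq_tsum_inter_fiber μ (hX.measurable m), ENNReal.tsum_eq_zero]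
  intro x
  rw [← hle x]
  congr 1
  ext ω
  simp only [Set.mem_inter_iff, Set.mem_preimage, Set.mem_singleton_iff, Set.mem_ofPred_eq,
    not_exists, not_and]
  constructor
  · rintro ⟨h1, h2⟩
    exact ⟨h2, fun k => h1 _ (by omega)⟩
  · rintro ⟨h1, h2⟩
    refine ⟨fun n hn => ?_, h1⟩
    obtain ⟨k, rfl⟩ := Nat.exists_eq_add_of_lt hn
    rw [add_right_comm]
    exact h2 k

end Recurrence

/-! ### Sampling after a random number of steps, and pairs of chains -/

/-- The transition matrix of a chain with matrix `K` sampled after a `ρ`-distributed number of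
steps. -/
noncomputable def mixPow {S : Type*} (ρ : Measure ℕ) (K : S → S → ℝ≥0∞) (x y : S) : ℝ≥0∞ :=
  ∑' d, ρ {d} * stepPow K d x y

section MatrixFacts

variable {S : Type*} {K : S → S → ℝ≥0∞}

theorem tsum_stepPow_le_one (hK : ∀ x, ∑' y, K x y ≤ 1) (d : ℕ) (x : S) :
    ∑' y, stepPow K d x y ≤ 1 := by
  classical
  induction d with
  | zero =>
    have h : (fun y => stepPow K 0 x y) = fun y => if y = x then 1 else 0 := by
      funext y
      simp [stepPow, eq_comm]
    rw [h, tsum_ite_eq]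
  | succ d ih =>
    simp only [stepPow]
    rw [ENNReal.tsum_comm]
    refine le_trans (ENNReal.tsum_le_tsum fun l => ?_) ih
    rw [ENNReal.tsum_mul_left]
    exact mul_le_of_le_one_right' (hK l)

theorem tsum_mul_stepPow {π : S → ℝ≥0∞} (hπ : ∀ y, ∑' x, π x * K x y = π y) (d : ℕ) (y : S) :
    ∑' x, π x * stepPow K d x y = π y := by
  classical
  induction d generalizing y with
  | zero =>
    have h : (fun x => π x * stepPow K 0 x y) = fun x => if x = y then π x else 0 := by
      funext x
      simp [stepPow]
    rw [h, tsum_ite_eq]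
  | succ d ih =>
    simp only [stepPow]
    simp_rw [← ENNReal.tsum_mul_left, ← mul_assoc]
    rw [ENNReal.tsum_comm]
    simp_rw [ENNReal.tsum_mul_right, ih, hπ]

theorem tsum_singleton_eq_one (ρ : Measure ℕ) [IsProbabilityMeasure ρ] : ∑' d, ρ {d} = 1 := by
  have h := measure_eq_tsum_inter_fiber ρ measurable_id (Set.univ : Set ℕ)
  simpa using h.symm

theorem tsum_mixPow_le_one (ρ : Measure ℕ) [IsProbabilityMeasure ρ] (hK : ∀ x, ∑' y, K x y ≤ 1)
    (x : S) : ∑' y, mixPow ρ K x y ≤ 1 := by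
  simp only [mixPow]
  rw [ENNReal.tsum_comm, ← tsum_singleton_eq_one ρ]
  refine ENNReal.tsum_le_tsum fun d => ?_
  rw [ENNReal.tsum_mul_left]
  exact mul_le_of_le_one_right' (tsum_stepPow_le_one hK d x)

theorem tsum_mul_mixPow (ρ : Measure ℕ) [IsProbabilityMeasure ρ] {π : S → ℝ≥0∞}
    (hπ : ∀ y, ∑' x, π x * K x y = π y) (y : S) : ∑' x, π x * mixPow ρ K x y = π y := by
  simp only [mixPow]
  have hcomm : ∀ x d, π x * (ρ {d} * stepPow K d x y) = ρ {d} * (π x * stepPow K d x y) :=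
    fun x d => mul_left_comm _ _ _
  simp_rw [← ENNReal.tsum_mul_left, hcomm]
  rw [ENNReal.tsum_comm]
  simp_rw [ENNReal.tsum_mul_left, tsum_mul_stepPow hπ, ENNReal.tsum_mul_right]
  rw [tsum_singleton_eq_one, one_mul]

theorem mixPow_ne_zero {ρ : Measure ℕ} (hρ : ∀ d, ρ {d} ≠ 0) {x y : S}
    (h : ∃ d, stepPow K d x y ≠ 0) : mixPow ρ K x y ≠ 0 := by
  obtain ⟨d, hd⟩ := h
  rw [mixPow, Ne, ENNReal.tsum_eq_zero]
  exact fun h => mul_ne_zero (hρ d) hd (h d)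

end MatrixFacts

theorem measurableSet_forall_lt_eq {Ω S : Type*} [MeasurableSpace Ω] [MeasurableSpace S]
    [MeasurableSingletonClass S] {X : ℕ → Ω → S} (hX : ∀ k, Measurable (X k)) (n : ℕ)
    (τ : ℕ → ℕ) (g : ℕ → S) : MeasurableSet {ω | ∀ k < n, X (τ k) ω = g k} := by
  have h : {ω | ∀ k < n, X (τ k) ω = g k} = ⋂ k, ⋂ _ : k < n, X (τ k) ⁻¹' {g k} := by
    ext ω
    simp
  rw [h]
  exact .iInter fun k => .iInter fun _ => hX _ (measurableSet_singleton _)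

/-- A Markov chain observed along an independent random walk with i.i.d. increments is a Markov
chain. -/
theorem HasTransitions.subordinate {Ω S : Type*} [MeasurableSpace Ω] [MeasurableSpace S]
    [Countable S] [MeasurableSingletonClass S] {μ : Measure Ω}
    {K : S → S → ℝ≥0∞} {Y X : ℕ → Ω → S} {D : ℕ → Ω → ℕ} {ρ : Measure ℕ}
    (hY : HasTransitions μ K Y) (hD : ∀ k, Measurable (D k)) (hDind : iIndepFun D μ)
    (hDlaw : ∀ k, μ.map (D k) = ρ) (hDY : IndepFun (fun ω k => D k ω) (fun ω k => Y k ω) μ)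
    (hX : ∀ n, Measurable (X n))
    (hXY : ∀ᵐ ω ∂μ, ∀ n, X n ω = Y (∑ j ∈ Finset.range n, D j ω) ω) :
    HasTransitions μ (mixPow ρ K) X := by
  refine ⟨hX, fun n i => ?_⟩
  have hae : ∀ m, μ {ω | ∀ k ≤ m, X k ω = i k} =
      μ {ω | ∀ k ≤ m, Y (∑ j ∈ Finset.range k, D j ω) ω = i k} := by
    intro m
    refine measure_congr ?_
    filter_upwards [hXY] with ω hω
    refine propext ?_
    change (∀ k ≤ m, X k ω = i k) ↔ ∀ k ≤ m, Y (∑ j ∈ Finset.range k, D j ω) ω = i k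
    simp only [hω]
  rw [hae, hae]
  have hH : Measurable (fun ω (k : Fin n) => D k ω) := measurable_pi_lambda _ fun k => hD k
  have hDpi : Measurable (fun ω k => D k ω) := measurable_pi_lambda _ hD
  -- Fixing the first `n` increments makes the observation times deterministic, so that independence
  -- from `Y` applies.
  rw [measure_eq_tsum_inter_fiber μ hH, measure_eq_tsum_inter_fiber μ hH
    {ω | ∀ k ≤ n, Y (∑ j ∈ Finset.range k, D j ω) ω = i k}, ← ENNReal.tsum_mul_right]
  refine tsum_congr fun h => ?_
  by_cases hne : ∃ ω₀, (fun k : Fin n => D k ω₀) = h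
  swap
  · have h0 : (fun ω (k : Fin n) => D k ω) ⁻¹' {h} = ∅ := by
      ext ω
      simp only [Set.mem_preimage, Set.mem_singleton_iff, Set.mem_empty_iff_false, iff_false]
      exact fun h' => hne ⟨ω, h'⟩
    simp [h0]
  obtain ⟨ω₀, rfl⟩ := hne
  obtain ⟨g, hg⟩ : ∃ g : ℕ → ℕ, ∀ k, D k ω₀ = g k := ⟨fun k => D k ω₀, fun _ => rfl⟩
  obtain ⟨s, hs⟩ : ∃ s : ℕ → ℕ, s = fun k => ∑ j ∈ Finset.range k, g j := ⟨_, rfl⟩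
  have hsmono : ∀ k ≤ n, s k ≤ s n := fun k hk => by
    rw [hs]
    exact Finset.sum_le_sum_of_subset (Finset.range_mono hk)
  have hfib : ∀ ω, ω ∈ (fun ω (k : Fin n) => D k ω) ⁻¹' {fun k : Fin n => D k ω₀} ↔
      ∀ k < n, D k ω = g k := by
    intro ω
    simp only [Set.mem_preimage, Set.mem_singleton_iff, hg]
    exact ⟨fun h k hk => congrFun h ⟨k, hk⟩, fun h => funext fun k => h k k.2⟩
  have hsum : ∀ ω, (∀ k < n, D k ω = g k) → ∀ k ≤ n, ∑ j ∈ Finset.range k, D j ω = s k := by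
    intro ω hω k hk
    rw [hs]
    exact Finset.sum_congr rfl fun j hj => hω j ((Finset.mem_range.1 hj).trans_le hk)
  have hA : MeasurableSet {d : ℕ → ℕ | ∀ k < n, d k = g k} :=
    measurableSet_forall_lt_eq (X := fun k (d : ℕ → ℕ) => d k) measurable_pi_apply n id g
  have hB : MeasurableSet {y : ℕ → S | ∀ k ≤ n, y (s k) = i k} := by
    simpa only [Nat.lt_succ_iff] using
      measurableSet_forall_lt_eq (X := fun k (y : ℕ → S) => y k) measurable_pi_apply (n + 1) s i
  have hlast : ∀ e, μ {ω | (∀ k < n, D k ω = g k) ∧ D n ω = e} =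
      μ {ω | ∀ k < n, D k ω = g k} * ρ {e} := by
    intro e
    -- One family of sets serves both ranges, so the product over `n + 1` factors is the product
    -- over `n` times the last factor.
    have h1 := hDind.measure_inter_preimage_eq_mul (Finset.range (n + 1))
      (sets := fun k => if k < n then {g k} else {e}) (fun k _ => .of_discrete)
    have h2 := hDind.measure_inter_preimage_eq_mul (Finset.range n)
      (sets := fun k => if k < n then {g k} else {e}) (fun k _ => .of_discrete)
    rw [Finset.prod_range_succ, ← h2] at h1
    simp only [lt_irrefl, if_false] at h1
    rw [← hDlaw n, Measure.map_apply (hD n) (measurableSet_singleton e)]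
    convert h1 using 2
    · ext ω
      simp only [Set.mem_ofPred_eq, Set.mem_iInter, Finset.mem_range, Set.mem_preimage]
      constructor
      · rintro ⟨h1, h2⟩ k hk
        by_cases hkn : k < n
        · simpa [hkn] using h1 k hkn
        · obtain rfl : k = n := by omega
          simpa using h2
      · intro h
        refine ⟨fun k hk => ?_, by simpa using h n (by omega)⟩
        simpa [hk] using h k (by omega)
    · congr 1
      ext ω
      simp only [Set.mem_ofPred_eq, Set.mem_iInter, Finset.mem_range, Set.mem_preimage]
      refine forall₂_congr fun k hk => ?_
      simp [hk]
  have hright : μ ({ω | ∀ k ≤ n, Y (∑ j ∈ Finset.range k, D j ω) ω = i k} ∩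
      (fun ω (k : Fin n) => D k ω) ⁻¹' {fun k : Fin n => D k ω₀}) =
      μ {ω | ∀ k < n, D k ω = g k} * μ {ω | ∀ k ≤ n, Y (s k) ω = i k} := by
    have h1 := hDY.measure_inter_preimage_eq_mul _ _ hA hB
    simp only [Set.preimage_ofPred_eq] at h1
    rw [← h1]
    congr 1
    ext ω
    rw [Set.mem_inter_iff, hfib, Set.mem_inter_iff, and_comm]
    refine and_congr_right fun h => ?_
    refine forall₂_congr fun k hk => ?_
    rw [hsum ω h k hk]
  have hleft : ∀ e, μ ({ω | ∀ k ≤ n + 1, Y (∑ j ∈ Finset.range k, D j ω) ω = i k} ∩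
      (fun ω (k : Fin n) => D k ω) ⁻¹' {fun k : Fin n => D k ω₀} ∩ D n ⁻¹' {e}) =
      μ {ω | ∀ k < n, D k ω = g k} * ρ {e} *
        (μ {ω | ∀ k ≤ n, Y (s k) ω = i k} * stepPow K e (i n) (i (n + 1))) := by
    intro e
    have hAe : MeasurableSet {d : ℕ → ℕ | (∀ k < n, d k = g k) ∧ d n = e} := by
      have hn : MeasurableSet ((fun d : ℕ → ℕ => d n) ⁻¹' {e}) :=
        measurable_pi_apply n (measurableSet_singleton e)
      exact hA.inter hn
    have hBe : MeasurableSet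
        {y : ℕ → S | (∀ k ≤ n, y (s k) = i k) ∧ y (s n + e) = i (n + 1)} := by
      have hn : MeasurableSet ((fun y : ℕ → S => y (s n + e)) ⁻¹' {i (n + 1)}) :=
        measurable_pi_apply _ (measurableSet_singleton _)
      exact hB.inter hn
    have h1 := hDY.measure_inter_preimage_eq_mul _ _ hAe hBe
    simp only [Set.preimage_ofPred_eq] at h1
    have hpast : IsPastEvent Y (s n) {ω | ∀ k ≤ n, Y (s k) ω = i k} := by
      intro ω ω' hk hω k hkn
      rw [← hk _ (hsmono k hkn)]
      exact hω k hkn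
    have h2 := hY.measure_inter_steps hpast (i n) e (i (n + 1))
    have h3 : {ω | ∀ k ≤ n, Y (s k) ω = i k} ∩ Y (s n) ⁻¹' {i n} =
        {ω | ∀ k ≤ n, Y (s k) ω = i k} :=
      Set.inter_eq_left.2 fun ω hω => hω n le_rfl
    rw [h3] at h2
    rw [← hlast, ← h2]
    refine Eq.trans (congrArg μ ?_) h1
    ext ω
    simp only [Set.mem_inter_iff, hfib, Set.mem_ofPred_eq, Set.mem_preimage,
      Set.mem_singleton_iff]
    constructor
    · rintro ⟨⟨h1, h2⟩, h3⟩
      refine ⟨⟨h2, h3⟩, fun k hk => ?_, ?_⟩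
      · rw [← hsum ω h2 k hk]
        exact h1 k (by omega)
      · have := h1 (n + 1) le_rfl
        rwa [Finset.sum_range_succ, hsum ω h2 n le_rfl, h3] at this
    · rintro ⟨⟨h2, h3⟩, h4, h5⟩
      refine ⟨⟨fun k hk => ?_, h2⟩, h3⟩
      by_cases hkn : k ≤ n
      · rw [hsum ω h2 k hkn]
        exact h4 k hkn
      · obtain rfl : k = n + 1 := by omega
        rw [Finset.sum_range_succ, hsum ω h2 n le_rfl, h3]
        exact h5
  -- Splitting further by the value `e` of the last increment produces the sum defining `mixPow`.
  rw [measure_eq_tsum_inter_fiber μ (hD n), hright, mixPow, ← ENNReal.tsum_mul_left]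
  refine tsum_congr fun e => ?_
  rw [hleft]
  ring

/-- Two independent Markov chains form a Markov chain. -/
theorem HasTransitions.prodMk {Ω S T : Type*} [MeasurableSpace Ω] [MeasurableSpace S]
    [MeasurableSpace T] [MeasurableSingletonClass S] [MeasurableSingletonClass T] {μ : Measure Ω}
    {Q : S → S → ℝ≥0∞} {R : T → T → ℝ≥0∞} {X : ℕ → Ω → S} {Y : ℕ → Ω → T}
    (hX : HasTransitions μ Q X) (hY : HasTransitions μ R Y)
    (hXY : IndepFun (fun ω n => X n ω) (fun ω n => Y n ω) μ) :
    HasTransitions μ (fun a b : S × T => Q a.1 b.1 * R a.2 b.2) (fun n ω => (X n ω, Y n ω)) := by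
  refine ⟨fun n => (hX.measurable n).prodMk (hY.measurable n), fun n i => ?_⟩
  have hsplit : ∀ m, μ {ω | ∀ k ≤ m, (X k ω, Y k ω) = i k} =
      μ {ω | ∀ k ≤ m, X k ω = (i k).1} * μ {ω | ∀ k ≤ m, Y k ω = (i k).2} := by
    intro m
    have hA : MeasurableSet {x : ℕ → S | ∀ k ≤ m, x k = (i k).1} := by
      simpa only [Nat.lt_succ_iff, id] using measurableSet_forall_lt_eq
        (X := fun k (y : ℕ → S) => y k) measurable_pi_apply (m + 1) id fun k => (i k).1
    have hB : MeasurableSet {x : ℕ → T | ∀ k ≤ m, x k = (i k).2} := by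
      simpa only [Nat.lt_succ_iff, id] using measurableSet_forall_lt_eq
        (X := fun k (y : ℕ → T) => y k) measurable_pi_apply (m + 1) id fun k => (i k).2
    refine Eq.trans (congrArg μ ?_) (hXY.measure_inter_preimage_eq_mul _ _ hA hB)
    ext ω
    simp only [Set.mem_inter_iff, Set.mem_ofPred_eq, Set.mem_preimage, Prod.ext_iff]
    exact ⟨fun h => ⟨fun k hk => (h k hk).1, fun k hk => (h k hk).2⟩,
      fun h k hk => ⟨h.1 k hk, h.2 k hk⟩⟩
  rw [hsplit, hsplit, hX.markov, hY.markov]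
  ring

/-! ### Reversible measure of the birth-and-death chain and its total mass -/

section BirthDeath

/-- The reversible measure of the birth-and-death chain with forward probabilities `p`. -/
noncomputable def birthDeathWeight (p : ℕ → ℝ) : ℕ → ℝ
  | 0 => 1
  | n + 1 => birthDeathWeight p n * p n / (1 - p (n + 1))

variable {p : ℕ → ℝ}

theorem birthDeathWeight_pos (h0 : p 0 = 1) (hp : ∀ i, p (i + 1) ∈ Set.Ioo (0 : ℝ) 1) (n : ℕ) :
    0 < birthDeathWeight p n := by
  induction n with
  | zero => exact one_pos
  | succ n ih =>
    have h1 : 0 < 1 - p (n + 1) := sub_pos.2 (hp n).2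
    have h2 : 0 < p n := by
      cases n with
      | zero => rw [h0]; exact one_pos
      | succ n => exact (hp n).1
    exact div_pos (mul_pos ih h2) h1

/-- Detailed balance. Both sides vanish unless `i` and `j` are neighbours, and for neighbours it is
the recursion defining the weights. -/
theorem birthDeathWeight_mul_comm (hp : ∀ i, p (i + 1) ∈ Set.Ioo (0 : ℝ) 1) (i j : ℕ) :
    birthDeathWeight p i * birthDeathMatrix p i j =
      birthDeathWeight p j * birthDeathMatrix p j i := by
  have key : ∀ k, birthDeathWeight p k * birthDeathMatrix p k (k + 1) =
      birthDeathWeight p (k + 1) * birthDeathMatrix p (k + 1) k := by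
    intro k
    have h1 : 1 - p (k + 1) ≠ 0 := (sub_pos.2 (hp k).2).ne'
    simp only [birthDeathMatrix, birthDeathWeight, if_true]
    rw [if_neg (by omega)]
    field_simp
  by_cases h1 : j = i + 1
  · subst h1
    exact key i
  by_cases h2 : i = j + 1
  · subst h2
    exact (key j).symm
  simp [birthDeathMatrix, h1, h2]

theorem tsum_ofReal_birthDeathMatrix (h0 : p 0 = 1) (hp : ∀ i, p (i + 1) ∈ Set.Ioo (0 : ℝ) 1)
    (i : ℕ) : ∑' j, ENNReal.ofReal (birthDeathMatrix p i j) = 1 := by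
  cases i with
  | zero =>
    rw [tsum_eq_single 1]
    · simp [birthDeathMatrix, h0]
    · intro j hj
      simp [birthDeathMatrix, hj]
  | succ i =>
    have h : ∀ j, ENNReal.ofReal (birthDeathMatrix p (i + 1) j) =
        (if j = i + 2 then ENNReal.ofReal (p (i + 1)) else 0) +
          (if j = i then ENNReal.ofReal (1 - p (i + 1)) else 0) := by
      intro j
      unfold birthDeathMatrix
      by_cases h1 : j = i + 2
      · have h2 : j ≠ i := by omega
        simp [h1]
      · by_cases h2 : j = i
        · subst h2
          have h3 : j ≠ j + 1 + 1 := by omega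
          simp [h3]
        · have h3 : i ≠ j := Ne.symm h2
          simp [h1, h2, h3]
    simp_rw [h]
    rw [ENNReal.tsum_add, tsum_ite_eq, tsum_ite_eq,
      ← ENNReal.ofReal_add (hp i).1.le (sub_pos.2 (hp i).2).le]
    simp

theorem tsum_birthDeathWeight_mul (h0 : p 0 = 1) (hp : ∀ i, p (i + 1) ∈ Set.Ioo (0 : ℝ) 1)
    (j : ℕ) : ∑' i, ENNReal.ofReal (birthDeathWeight p i) *
      ENNReal.ofReal (birthDeathMatrix p i j) = ENNReal.ofReal (birthDeathWeight p j) := by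
  simp_rw [← ENNReal.ofReal_mul (birthDeathWeight_pos h0 hp _).le,
    birthDeathWeight_mul_comm hp _ j, ENNReal.ofReal_mul (birthDeathWeight_pos h0 hp j).le]
  rw [ENNReal.tsum_mul_left, tsum_ofReal_birthDeathMatrix h0 hp, mul_one]

/-- The set of states reachable from `i` is closed under moves to either neighbour, so it contains
either all states or none; it contains `i`, in zero steps. -/
theorem exists_stepPow_ne_zero {K : ℕ → ℕ → ℝ≥0∞} (hup : ∀ i, K i (i + 1) ≠ 0)
    (hdown : ∀ i, K (i + 1) i ≠ 0) (i j : ℕ) : ∃ d, stepPow K d i j ≠ 0 := by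
  have hstep : ∀ l m, K l m ≠ 0 → (∃ d, stepPow K d i l ≠ 0) → ∃ d, stepPow K d i m ≠ 0 := by
    rintro l m hlm ⟨d, hd⟩
    refine ⟨d + 1, fun h => ?_⟩
    simp only [stepPow] at h
    exact mul_ne_zero hd hlm (ENNReal.tsum_eq_zero.1 h l)
  have hiff : ∀ j, (∃ d, stepPow K d i j ≠ 0) ↔ ∃ d, stepPow K d i 0 ≠ 0 := by
    intro j
    induction j with
    | zero => rfl
    | succ j ih => exact (Iff.intro (hstep _ _ (hdown j)) (hstep _ _ (hup j))).trans ih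
  exact (hiff j).2 ((hiff i).1 ⟨0, by simp [stepPow]⟩)

theorem exists_stepPow_birthDeath_ne_zero (h0 : p 0 = 1)
    (hp : ∀ i, p (i + 1) ∈ Set.Ioo (0 : ℝ) 1) (i j : ℕ) :
    ∃ d, stepPow (fun i j => ENNReal.ofReal (birthDeathMatrix p i j)) d i j ≠ 0 := by
  refine exists_stepPow_ne_zero (fun i => ?_) (fun i => ?_) i j
  · rw [Ne, ENNReal.ofReal_eq_zero, not_le, birthDeathMatrix, if_pos rfl]
    cases i with
    | zero => rw [h0]; exact one_pos
    | succ i => exact (hp i).1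
  · rw [Ne, ENNReal.ofReal_eq_zero, not_le, birthDeathMatrix, if_neg (by omega), if_pos rfl]
    exact sub_pos.2 (hp i).2

/-- In the electrical picture the edge between `n` and `n + 1` has conductance $e^{-V_n}$, and the
weight of a vertex is the sum of its adjacent conductances. This turns summability of the weights
into growth of the potential $V$. -/
theorem birthDeathWeight_succ (h0 : p 0 = 1) (hp : ∀ i, p (i + 1) ∈ Set.Ioo (0 : ℝ) 1) (n : ℕ) :
    birthDeathWeight p (n + 1) =
      Real.exp (-∑ i ∈ Finset.range n, Real.log ((1 - p (i + 1)) / p (i + 1))) +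
        Real.exp (-∑ i ∈ Finset.range (n + 1), Real.log ((1 - p (i + 1)) / p (i + 1))) := by
  have hexp : ∀ n, Real.exp (-∑ i ∈ Finset.range (n + 1),
      Real.log ((1 - p (i + 1)) / p (i + 1))) =
      Real.exp (-∑ i ∈ Finset.range n, Real.log ((1 - p (i + 1)) / p (i + 1))) *
        (p (n + 1) / (1 - p (n + 1))) := by
    intro n
    rw [Finset.sum_range_succ, neg_add, Real.exp_add, ← Real.log_inv, inv_div,
      Real.exp_log (div_pos (hp n).1 (sub_pos.2 (hp n).2))]
  -- The flow across the edge between `n` and `n + 1` is its conductance.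
  have hmul : ∀ n, birthDeathWeight p (n + 1) * (1 - p (n + 1)) =
      Real.exp (-∑ i ∈ Finset.range n, Real.log ((1 - p (i + 1)) / p (i + 1))) := by
    intro n
    have h1 : 1 - p (n + 1) ≠ 0 := (sub_pos.2 (hp n).2).ne'
    induction n with
    | zero =>
      simp only [birthDeathWeight, h0, Finset.range_zero, Finset.sum_empty, neg_zero,
        Real.exp_zero]
      field_simp
    | succ n ih =>
      have h2 : 1 - p (n + 1) ≠ 0 := (sub_pos.2 (hp n).2).ne'
      rw [hexp, ← ih h2, birthDeathWeight]
      field_simp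
  have h1 : 1 - p (n + 1) ≠ 0 := (sub_pos.2 (hp n).2).ne'
  rw [hexp, ← hmul]
  field_simp
  ring

theorem tsum_birthDeathWeight_ne_top (h0 : p 0 = 1) (hp : ∀ i, p (i + 1) ∈ Set.Ioo (0 : ℝ) 1)
    {c : ℝ} (hc : 0 < c)
    (hV : ∀ᶠ n : ℕ in atTop,
      c * n ≤ ∑ i ∈ Finset.range n, Real.log ((1 - p (i + 1)) / p (i + 1))) :
    ∑' n, ENNReal.ofReal (birthDeathWeight p n) ≠ ∞ := by
  have hexp : Summable fun n : ℕ =>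
      Real.exp (-∑ i ∈ Finset.range n, Real.log ((1 - p (i + 1)) / p (i + 1))) := by
    refine Summable.of_norm_bounded_eventually_nat (g := fun n : ℕ => Real.exp (-c) ^ n)
      (summable_geometric_of_lt_one (Real.exp_pos _).le (by simpa using hc)) ?_
    filter_upwards [hV] with n hn
    rw [Real.norm_of_nonneg (Real.exp_pos _).le, ← Real.exp_nat_mul]
    exact Real.exp_le_exp.2 (by linarith)
  have hsum : Summable (birthDeathWeight p) := by
    rw [← summable_nat_add_iff 1]
    simp_rw [birthDeathWeight_succ h0 hp]
    exact hexp.add ((summable_nat_add_iff 1).2 hexp)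
  exact hsum.tsum_ofReal_ne_top

end BirthDeath

/-! ### Law of large numbers with a possibly infinite mean -/

section LargeNumbers

variable {Ω : Type*} [MeasurableSpace Ω] {P : Measure Ω}

/-- Truncating from above at `M ≥ 0` leaves the negative part unchanged, while the mean of the
positive part increases to its full value by monotone convergence. The truncated variable is
integrable, so the usual strong law applies to it even if the original mean is `+∞`. -/
theorem HasPositiveMean.exists_truncation {X : Ω → ℝ} (hX : Measurable X)
    (h : HasPositiveMean P X) :
    ∃ M : ℕ, HasPositiveMean P fun ω => min (X ω) M := by
  have hsup : ∀ ω, ENNReal.ofReal (X ω) = ⨆ M : ℕ, ENNReal.ofReal (min (X ω) M) := by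
    intro ω
    refine le_antisymm ?_ (iSup_le fun M => ENNReal.ofReal_le_ofReal (min_le_left _ _))
    obtain ⟨M, hM⟩ := exists_nat_ge (X ω)
    exact le_iSup_of_le M (by rw [min_eq_left hM])
  have h' := h
  unfold HasPositiveMean at h'
  simp_rw [hsup] at h'
  rw [lintegral_iSup (fun M => (hX.min measurable_const).ennreal_ofReal)
    (fun M N hMN ω => ENNReal.ofReal_le_ofReal
      (min_le_min le_rfl (by exact_mod_cast hMN)))] at h'
  obtain ⟨M, hM⟩ := lt_iSup_iff.1 h'
  refine ⟨M, lt_of_eq_of_lt (lintegral_congr fun ω => ?_) hM⟩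
  dsimp only
  rcases le_total (X ω) M with h1 | h1
  · rw [min_eq_left h1]
  · rw [min_eq_right h1, ENNReal.ofReal_of_nonpos (by simp), ENNReal.ofReal_of_nonpos]
    have : (0 : ℝ) ≤ M := M.cast_nonneg
    linarith

theorem HasPositiveMean.integrable_and_integral_pos [IsFiniteMeasure P] {X : Ω → ℝ}
    (hX : Measurable X) (h : HasPositiveMean P X) {M : ℝ} (hM : ∀ ω, X ω ≤ M) :
    Integrable X P ∧ 0 < ∫ ω, X ω ∂P := by
  have hpos : ∫⁻ ω, ENNReal.ofReal (X ω) ∂P ≠ ∞ := by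
    refine ne_top_of_le_ne_top ?_ (lintegral_mono fun ω => ENNReal.ofReal_le_ofReal (hM ω))
    rw [lintegral_const]
    exact ENNReal.mul_ne_top ENNReal.ofReal_ne_top (measure_ne_top _ _)
  have hneg : ∫⁻ ω, ENNReal.ofReal (-X ω) ∂P ≠ ∞ := (lt_top_of_lt h).ne
  have hint : Integrable X P := by
    have h1 : Integrable (fun ω => max (X ω) 0) P := by
      refine (lintegral_ofReal_ne_top_iff_integrable
        (hX.max (measurable_const (a := (0 : ℝ)))).aestronglyMeasurable
        (ae_of_all _ fun ω => le_max_right _ _)).1 ?_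
      simpa [ENNReal.ofReal_max] using hpos
    have h2 : Integrable (fun ω => max (-X ω) 0) P := by
      refine (lintegral_ofReal_ne_top_iff_integrable
        (hX.neg.max (measurable_const (a := (0 : ℝ)))).aestronglyMeasurable
        (ae_of_all _ fun ω => le_max_right _ _)).1 ?_
      simpa [ENNReal.ofReal_max] using hneg
    refine (h1.sub h2).congr (ae_of_all _ fun ω => ?_)
    change max (X ω) 0 - max (-X ω) 0 = X ω
    rcases le_total (X ω) 0 with h | h
    · rw [max_eq_right h, max_eq_left (by linarith)]; ring
    · rw [max_eq_left h, max_eq_right (by linarith)]; ring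
  refine ⟨hint, ?_⟩
  rw [integral_eq_lintegral_pos_part_sub_lintegral_neg_part hint, sub_pos]
  exact (ENNReal.toReal_lt_toReal hneg hpos).2 h

/-- Linear growth of the partial sums of i.i.d. random variables whose expectation is well defined
and positive, possibly infinite. -/
theorem HasPositiveMean.ae_eventually_le_sum [IsFiniteMeasure P] {X : ℕ → Ω → ℝ}
    (hX : ∀ i, Measurable (X i)) (h : HasPositiveMean P (X 0)) (hind : iIndepFun X P)
    (hid : ∀ i, IdentDistrib (X i) (X 0) P P) :
    ∃ c > 0, ∀ᵐ ω ∂P, ∀ᶠ n : ℕ in atTop, c * n ≤ ∑ i ∈ Finset.range n, X i ω := by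
  obtain ⟨M, hM⟩ := h.exists_truncation (hX 0)
  have hmin : Measurable fun x : ℝ => min x M := measurable_id.min measurable_const
  obtain ⟨hint, hpos⟩ := hM.integrable_and_integral_pos (hmin.comp (hX 0))
    (M := M) fun ω => min_le_right _ _
  -- Half the truncated mean lies strictly below the limit of the truncated averages, and the
  -- untruncated sums dominate the truncated ones.
  refine ⟨(∫ ω, min (X 0 ω) M ∂P) / 2, half_pos hpos, ?_⟩
  have hlaw := strong_law_ae_real (fun i ω => min (X i ω) M) hint
    (fun i j hij => (hind.indepFun hij).comp hmin hmin) (fun i => (hid i).comp hmin)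
  filter_upwards [hlaw] with ω hω
  filter_upwards [hω.eventually_const_le (half_lt_self hpos), eventually_gt_atTop 0] with n hn hn0
  rw [le_div_iff₀ (by exact_mod_cast hn0)] at hn
  exact hn.trans (Finset.sum_le_sum fun i _ => min_le_left _ _)

theorem IsEnvironment.ae_tsum_birthDeathWeight_ne_top [IsProbabilityMeasure P] {p : ℕ → Ω → ℝ}
    (hp : IsEnvironment P p) :
    ∀ᵐ ω ∂P, ∑' n, ENNReal.ofReal (birthDeathWeight (fun i => p i ω) n) ≠ ∞ := by
  have hlog : Measurable fun x : ℝ => Real.log ((1 - x) / x) := by fun_prop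
  obtain ⟨c, hc, h⟩ := HasPositiveMean.ae_eventually_le_sum
    (X := fun i ω => Real.log ((1 - p (i + 1) ω) / p (i + 1) ω))
    (fun i => hlog.comp (hp.measurable _)) hp.drift (hp.indep.comp _ fun _ => hlog)
    (fun i => (hp.identDistrib i).comp hlog)
  filter_upwards [h] with ω hω
  exact tsum_birthDeathWeight_ne_top (hp.zero ω) (fun i => hp.mem_Ioo i ω) hc hω

end LargeNumbers

/-! ### The walks at integer times -/

theorem IsMarkovChain.hasTransitions {Ω : Type*} [MeasurableSpace Ω] {μ : Measure Ω}
    {K : ℕ → ℕ → ℝ} {Y : ℕ → Ω → ℕ} (h : IsMarkovChain μ K Y) :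
    HasTransitions μ (fun i j => ENNReal.ofReal (K i j)) Y :=
  ⟨h.measurable, h.markov⟩

theorem poissonMeasure_one_singleton_ne_zero (d : ℕ) : poissonMeasure 1 {d} ≠ 0 := by
  rw [poissonMeasure_singleton, Ne, ENNReal.ofReal_eq_zero, not_le]
  positivity

/-- The birth-and-death chain observed at integer times. -/
theorem IsBirthDeathChain.hasTransitions {Ω : Type*} [MeasurableSpace Ω] {μ : Measure Ω}
    {p : ℕ → ℝ} {Z : ℝ≥0 → Ω → ℕ} (h : IsBirthDeathChain μ p Z) :
    HasTransitions μ
      (mixPow (poissonMeasure 1) fun i j => ENNReal.ofReal (birthDeathMatrix p i j))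
      (fun (n : ℕ) ω => Z n ω) := by
  obtain ⟨N, Y, hN, hY, hNY, hZ⟩ := h.exists_jumpChain
  have hmono : Monotone fun k : ℕ => (k : ℝ≥0) := Nat.mono_cast
  have hincr : Measurable fun (x : ℝ≥0 → ℕ) (k : ℕ) => x ((k + 1 : ℕ) : ℝ≥0) - x (k : ℝ≥0) :=
    measurable_pi_lambda _ fun k => (measurable_pi_apply _).sub (measurable_pi_apply _)
  refine hY.hasTransitions.subordinate
    (D := fun (k : ℕ) ω => N ((k + 1 : ℕ) : ℝ≥0) ω - N (k : ℝ≥0) ω)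
    (fun k => (hN.measurable _).sub (hN.measurable _)) (hN.indepIncrements.nat hmono)
    (fun k => ?_) (hNY.comp hincr measurable_id) (fun n => h.measurable n) ?_
  · rw [hN.increments _ _ (hmono k.le_succ)]
    congr 1
    simp
  -- The increments are truncated differences of natural numbers; monotonicity of the clock makes
  -- them telescope.
  · filter_upwards [hZ, hN.zero, hN.mono] with ω hZω h0 hmon n
    rw [hZω, Finset.sum_range_tsub (f := fun k : ℕ => N (k : ℝ≥0) ω) (hmon.comp hmono),
      Nat.cast_zero, h0, Nat.sub_zero]

/-- Two independent birth-and-death chains with summable reversible measures visit every pair of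
states at infinitely many integer times. -/
theorem IsBirthDeathChain.ae_frequently_eq {Ω : Type*} [MeasurableSpace Ω] {μ : Measure Ω}
    [IsProbabilityMeasure μ] {p q : ℕ → ℝ} {Z W : ℝ≥0 → Ω → ℕ}
    (hp0 : p 0 = 1) (hp : ∀ i, p (i + 1) ∈ Set.Ioo (0 : ℝ) 1)
    (hpsum : ∑' n, ENNReal.ofReal (birthDeathWeight p n) ≠ ∞)
    (hq0 : q 0 = 1) (hq : ∀ i, q (i + 1) ∈ Set.Ioo (0 : ℝ) 1)
    (hqsum : ∑' n, ENNReal.ofReal (birthDeathWeight q n) ≠ ∞)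
    (hZ : IsBirthDeathChain μ p Z) (hW : IsBirthDeathChain μ q W)
    (hZW : IndepFun (fun ω t => Z t ω) (fun ω t => W t ω) μ) (o : ℕ × ℕ) :
    ∀ᵐ ω ∂μ, ∀ m : ℕ, ∃ n : ℕ, m < n ∧ (Z n ω, W n ω) = o := by
  have hsample : Measurable fun (x : ℝ≥0 → ℕ) (n : ℕ) => x (n : ℝ≥0) :=
    measurable_pi_lambda _ fun n => measurable_pi_apply _
  have hpair := hZ.hasTransitions.prodMk hW.hasTransitions (hZW.comp hsample hsample)
  refine hpair.ae_frequently_eq (o := o)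
    (π := fun a => ENNReal.ofReal (birthDeathWeight p a.1) *
      ENNReal.ofReal (birthDeathWeight q a.2)) ?_ ?_ ?_ ?_ ?_
  · rintro ⟨a, b⟩
    rw [ENNReal.tsum_prod']
    simp_rw [ENNReal.tsum_mul_left, ENNReal.tsum_mul_right]
    exact mul_le_one' (tsum_mixPow_le_one _ (fun x => (tsum_ofReal_birthDeathMatrix hp0 hp x).le) _)
      (tsum_mixPow_le_one _ (fun x => (tsum_ofReal_birthDeathMatrix hq0 hq x).le) _)
  · intro a b
    exact mul_ne_zero
      (mixPow_ne_zero poissonMeasure_one_singleton_ne_zero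
        (exists_stepPow_birthDeath_ne_zero hp0 hp _ _))
      (mixPow_ne_zero poissonMeasure_one_singleton_ne_zero
        (exists_stepPow_birthDeath_ne_zero hq0 hq _ _))
  · rw [ENNReal.tsum_prod']
    simp_rw [ENNReal.tsum_mul_left, ENNReal.tsum_mul_right]
    exact ENNReal.mul_ne_top hpsum hqsum
  · rintro ⟨a, b⟩
    rw [ENNReal.tsum_prod']
    refine (tsum_congr fun c => tsum_congr fun d => mul_mul_mul_comm _ _ _ _).trans ?_
    simp_rw [ENNReal.tsum_mul_left, ENNReal.tsum_mul_right,
      tsum_mul_mixPow _ (tsum_birthDeathWeight_mul hp0 hp),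
      tsum_mul_mixPow _ (tsum_birthDeathWeight_mul hq0 hq)]
  · refine mul_ne_zero ?_ ?_
    · exact (ENNReal.ofReal_pos.2 (birthDeathWeight_pos hp0 hp _)).ne'
    · exact (ENNReal.ofReal_pos.2 (birthDeathWeight_pos hq0 hq _)).ne'

/-! ### The Beta distribution as an example -/

section Beta

theorem log_one_sub_div_self_symm (x : ℝ) :
    Real.log ((1 - (1 - x)) / (1 - x)) = -Real.log ((1 - x) / x) := by
  rw [sub_sub_cancel, ← Real.log_inv, inv_div]

/-- After removing the common factor $(x(1-x))^{a-1}$, the comparison is $x^{b-a}<(1-x)^{b-a}$. -/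
theorem betaPDFReal_reflect_lt {a b x : ℝ} (ha : 0 < a) (hab : a < b) (hx : 0 < x)
    (hx2 : x < 1 / 2) : betaPDFReal a b (1 - x) < betaPDFReal a b x := by
  rw [betaPDFReal, betaPDFReal, if_pos ⟨by linarith, by linarith⟩, if_pos ⟨hx, by linarith⟩,
    sub_sub_cancel, mul_assoc, mul_assoc]
  refine mul_lt_mul_of_pos_left ?_ (one_div_pos.2 (beta_pos ha (ha.trans hab)))
  have h1 : 0 < 1 - x := by linarith
  have h2 : x ^ (b - 1) = x ^ (a - 1) * x ^ (b - a) := by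
    rw [← Real.rpow_add hx]; congr 1; ring
  have h3 : (1 - x) ^ (b - 1) = (1 - x) ^ (a - 1) * (1 - x) ^ (b - a) := by
    rw [← Real.rpow_add h1]; congr 1; ring
  have h4 : x ^ (b - a) < (1 - x) ^ (b - a) :=
    Real.rpow_lt_rpow hx.le (by linarith) (by linarith)
  have h5 : 0 < x ^ (a - 1) * (1 - x) ^ (a - 1) :=
    mul_pos (Real.rpow_pos_of_pos hx _) (Real.rpow_pos_of_pos h1 _)
  rw [h2, h3]
  nlinarith [mul_lt_mul_of_pos_left h4 h5]

/-- The bound $\log y\le y^\varepsilon/\varepsilon$ with $y=x/(1-x)$ dominates the integrand by a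
multiple of the Beta$(a+\varepsilon,b-\varepsilon)$ density. -/
theorem lintegral_betaPDF_mul_neg_log_ne_top {a b : ℝ} (ha : 0 < a) (hb : 0 < b) :
    ∫⁻ x, betaPDF a b x * ENNReal.ofReal (-Real.log ((1 - x) / x)) ≠ ∞ := by
  -- Any `ε` in `(0, b)` would do: the second parameter `b - ε` has to stay positive.
  set ε := b / 2 with hε
  have hε0 : 0 < ε := half_pos hb
  have hbε : 0 < b - ε := by rw [hε]; linarith
  have hbound : ∀ x, betaPDF a b x * ENNReal.ofReal (-Real.log ((1 - x) / x)) ≤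
      ENNReal.ofReal (beta (a + ε) (b - ε) / beta a b / ε) * betaPDF (a + ε) (b - ε) x := by
    intro x
    by_cases hx : 0 < x ∧ x < 1
    swap
    · rw [betaPDF, betaPDFReal, if_neg hx]
      simp
    have h1 : 0 < 1 - x := sub_pos.2 hx.2
    have hB := beta_pos ha hb
    have hB' := beta_pos (add_pos ha hε0) hbε
    rw [betaPDF, betaPDF, ← ENNReal.ofReal_mul (betaPDFReal_pos hx.1 hx.2 ha hb).le,
      ← ENNReal.ofReal_mul (by positivity)]
    refine ENNReal.ofReal_le_ofReal ?_
    have hlog : -Real.log ((1 - x) / x) ≤ x ^ ε * (1 - x) ^ (-ε) / ε := by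
      rw [← Real.log_inv, inv_div]
      refine (Real.log_le_rpow_div (div_pos hx.1 h1).le hε0).trans_eq ?_
      rw [Real.div_rpow hx.1.le h1.le, Real.rpow_neg h1.le, div_eq_mul_inv (x ^ ε)]
    refine (mul_le_mul_of_nonneg_left hlog (betaPDFReal_pos hx.1 hx.2 ha hb).le).trans_eq ?_
    rw [betaPDFReal, betaPDFReal, if_pos hx, if_pos hx]
    have h2 : x ^ (a + ε - 1) = x ^ (a - 1) * x ^ ε := by
      rw [← Real.rpow_add hx.1]; congr 1; ring
    have h3 : (1 - x) ^ (b - ε - 1) = (1 - x) ^ (b - 1) * (1 - x) ^ (-ε) := by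
      rw [← Real.rpow_add h1]; congr 1; ring
    rw [h2, h3]
    have := hB.ne'
    have := hB'.ne'
    field_simp
  have hpdf : Measurable (betaPDF (a + ε) (b - ε)) := (measurable_betaPDFReal _ _).ennreal_ofReal
  refine ne_top_of_le_ne_top ?_ (lintegral_mono hbound)
  rw [lintegral_const_mul _ hpdf,
    lintegral_betaPDF_eq_one (add_pos ha hε0) hbε, mul_one]
  exact ENNReal.ofReal_ne_top

theorem hasPositiveMean_betaMeasure {a b : ℝ} (ha : 0 < a) (hab : a < b) :
    HasPositiveMean (betaMeasure a b) fun x => Real.log ((1 - x) / x) := by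
  have hlog : Measurable fun x : ℝ => Real.log ((1 - x) / x) := by fun_prop
  have hpdf : Measurable (betaPDF a b) := (measurable_betaPDFReal a b).ennreal_ofReal
  have hneg : Measurable fun x : ℝ => ENNReal.ofReal (-Real.log ((1 - x) / x)) :=
    hlog.neg.ennreal_ofReal
  unfold HasPositiveMean betaMeasure
  dsimp only
  rw [lintegral_withDensity_eq_lintegral_mul _ hpdf hneg,
    lintegral_withDensity_eq_lintegral_mul _ hpdf hlog.ennreal_ofReal]
  simp only [Pi.mul_apply]
  have hfin := lintegral_betaPDF_mul_neg_log_ne_top ha (ha.trans hab)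
  -- The reflection `x ↦ 1 - x` changes the sign of the logarithm, so both integrals carry the same
  -- factor and only the densities at `1 - x` and `x` are compared. The factor vanishes on `[1/2,
  -- 1)`; strictness comes from `(0, 1/2)`.
  rw [← lintegral_sub_left_eq_self (μ := volume)
    (fun x => betaPDF a b x * ENNReal.ofReal (-Real.log ((1 - x) / x))) (1 : ℝ)] at hfin ⊢
  simp only [log_one_sub_div_self_symm, neg_neg] at hfin ⊢
  refine lintegral_strict_mono_of_ae_le_of_ae_lt_on (s := Set.Ioo 0 (1 / 2))
    (hpdf.mul hlog.ennreal_ofReal).aemeasurable hfin (ae_of_all _ fun x => ?_) (by simp)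
    (ae_of_all _ fun x hx => ?_)
  · dsimp only
    -- Outside `(0, 1)` the logarithm has no controlled sign, but the density at `1 - x` is zero
    -- there.
    rcases le_or_gt x 0 with h0 | h0
    · rw [betaPDF_eq_zero_of_one_le (by linarith), zero_mul]
      exact zero_le
    rcases lt_or_ge x (1 / 2) with h2 | h2
    · exact mul_le_mul_left (ENNReal.ofReal_le_ofReal (betaPDFReal_reflect_lt ha hab h0 h2).le) _
    rcases le_or_gt 1 x with h1 | h1
    · rw [betaPDF_eq_zero_of_nonpos (by linarith), zero_mul]
      exact zero_le
    · rw [ENNReal.ofReal_of_nonpos, mul_zero]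
      · exact zero_le
      · exact Real.log_nonpos (div_nonneg (by linarith) h0.le)
          ((div_le_one h0).2 (by linarith))
  · have hL : 0 < Real.log ((1 - x) / x) :=
      Real.log_pos ((one_lt_div hx.1).2 (by linarith [hx.2]))
    refine ENNReal.mul_lt_mul_left (ENNReal.ofReal_pos.2 hL).ne' ENNReal.ofReal_ne_top ?_
    exact (ENNReal.ofReal_lt_ofReal_iff
      (betaPDFReal_pos hx.1 (by linarith [hx.2]) ha (ha.trans hab))).2
      (betaPDFReal_reflect_lt ha hab hx.1 hx.2)

end Beta

/-! ### From visits at integer times to the theorem -/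

theorem returnsInfinitelyOften_of_nat {S : Type*} {x : ℝ≥0 → S} {a : S}
    (haway : ∀ m : ℕ, ∃ n : ℕ, m < n ∧ x n ≠ a) (hback : ∀ m : ℕ, ∃ n : ℕ, m < n ∧ x n = a) :
    ReturnsInfinitelyOften x a := by
  intro T
  obtain ⟨m, hm⟩ := exists_nat_gt T
  obtain ⟨s, hms, hs⟩ := haway m
  obtain ⟨t, hst, ht⟩ := hback s
  exact ⟨s, t, hm.trans (by exact_mod_cast hms), by exact_mod_cast hst, hs, ht⟩

/-- `(Ω, P)` carries the two environments (whose joint law is not restricted), and `κ ω` is the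
law of the walks given the environments, so that `P ⊗ₘ κ` is the joint law of environments and
walks. In the last line `-Zl` is the mirrored chain on the non-positive integers. -/
theorem mainTheorem3 :
    (∀ a b : ℝ, 0 < a → a < b →
      HasPositiveMean (betaMeasure a b) (fun x => Real.log ((1 - x) / x))) ∧
    ∀ {Ω Ω' : Type*} [MeasurableSpace Ω] [MeasurableSpace Ω']
      (P : Measure Ω) [IsProbabilityMeasure P] (p₁ p₂ : ℕ → Ω → ℝ)
      (κ : Kernel Ω Ω') [IsMarkovKernel κ] (Zl Zr : ℝ≥0 → Ω' → ℕ),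
      IsEnvironment P p₁ → IsEnvironment P p₂ →
      (∀ᵐ ω ∂P, IsBirthDeathChain (κ ω) (fun i => p₁ i ω) Zr ∧
        IsBirthDeathChain (κ ω) (fun i => p₂ i ω) Zl ∧
        IndepFun (fun ω' t => Zl t ω') (fun ω' t => Zr t ω') (κ ω)) →
      ∀ᵐ x ∂(P ⊗ₘ κ),
        ReturnsInfinitelyOften (fun t => (Zl t x.2, Zr t x.2)) (0, 0) ∧
        ReturnsInfinitelyOften (fun t => (Zr t x.2 : ℤ) - (-(Zl t x.2 : ℤ))) 0 := by
  refine ⟨fun a b ha hab => hasPositiveMean_betaMeasure ha hab, ?_⟩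
  intro Ω Ω' _ _ P _ p₁ p₂ κ _ Zl Zr hp₁ hp₂ hZ
  -- Measurability of the walks does not depend on the environment, so a single good `ω₀` supplies
  -- it.
  obtain ⟨ω₀, hω₀⟩ := hZ.exists
  have hmeas : ∀ t, Measurable fun ω' => (Zl t ω', Zr t ω') := fun t =>
    (hω₀.2.1.measurable t).prodMk (hω₀.1.measurable t)
  have hvisit : ∀ o : ℕ × ℕ, ∀ᵐ x ∂(P ⊗ₘ κ), ∀ m : ℕ, ∃ n : ℕ, m < n ∧
      (Zl n x.2, Zr n x.2) = o := by
    intro o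
    refine Measure.ae_compProd_of_ae_ae ?_ ?_
    · have h : {x : Ω × Ω' | ∀ m : ℕ, ∃ n : ℕ, m < n ∧ (Zl n x.2, Zr n x.2) = o} =
          ⋂ m : ℕ, ⋃ n : ℕ, ⋃ _ : m < n,
            (fun x : Ω × Ω' => (Zl n x.2, Zr n x.2)) ⁻¹' {o} := by
        ext x
        simp
      rw [h]
      exact .iInter fun m => .iUnion fun n => .iUnion fun _ =>
        ((hmeas n).comp measurable_snd) (measurableSet_singleton o)
    · filter_upwards [hZ, hp₁.ae_tsum_birthDeathWeight_ne_top,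
        hp₂.ae_tsum_birthDeathWeight_ne_top] with ω hω h₁ h₂
      exact IsBirthDeathChain.ae_frequently_eq (hp₂.zero ω) (fun i => hp₂.mem_Ioo i ω) h₂
        (hp₁.zero ω) (fun i => hp₁.mem_Ioo i ω) h₁ hω.2.1 hω.1 hω.2.2 o
  -- Visits to `(1, 0)` serve as the times away from the target in both conclusions, since there the
  -- sum of the two coordinates is `1`.
  filter_upwards [hvisit (0, 0), hvisit (1, 0)] with x h0 h1
  constructor
  · refine returnsInfinitelyOften_of_nat (fun m => ?_) h0
    obtain ⟨n, hn, h⟩ := h1 m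
    exact ⟨n, hn, by rw [h]; simp⟩
  · refine returnsInfinitelyOften_of_nat (fun m => ?_) (fun m => ?_)
    · obtain ⟨n, hn, h⟩ := h1 m
      rw [Prod.mk.injEq] at h
      exact ⟨n, hn, by simp [h.1, h.2]⟩
    · obtain ⟨n, hn, h⟩ := h0 m
      rw [Prod.mk.injEq] at h
      exact ⟨n, hn, by simp [h.1, h.2]⟩
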